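/- Let $\mathcal{D}$ be a probability distribution on the non-negative integers with $\mathcal{D}(0)<1$ and finite mean $\lambda:=\mathbb{E}[\mathcal{D}]$. Let $p:=1-\mathcal{D}(0)$, let $\overline{\mathcal{D}}$ be the law $\mathcal{D}$ conditioned on the outcome being nonzero, and let $\overline{\lambda}:=\mathbb{E}[\overline{\mathcal{D}}]$. Write $\oplus$ for convolution of distributions and $\mathcal{D}^{\oplus x}$ for the $x$-fold convolution ($\mathcal{D}^{\oplus 0}$ is the point mass at $0$). The $\mathcal{D}$-repeat channel $\mathsf{Ch}$ receives a finite bit string and replaces each bit, independently, by a number of copies of that bit drawn from $\mathcal{D}$; its output is the resulting bit string. Its capacity is $$\mathsf{Cap}(\mathsf{Ch})=\limsup_{n\to\infty}\ \sup_{X}\ \frac{I(X;Y)}{n},$$ where $X$ ranges over all random $n$-bit strings, $Y$ is the output of the channel on input $X$, and $I$ is mutual information. For a transition rule $\mathcal{P}$ from a discrete input alphabet to the non-negative integers, and for a real $\mu\ge 0$, let $\mathsf{Cap}(\mathsf{Ch}_\mu(\mathcal{P}))$ be the supremum of $I(X;Y)$ over all random inputs $X$ whose corresponding output $Y$ satisfies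 $\mathbb{E}[Y]=\mu$ (and $0$ if there is no such $X$). Let $\mathcal{P}$ be the transition rule on positive integer inputs that maps $1+x$, $x\ge 0$, to a sample from $\overline{\mathcal{D}}\oplus\mathcal{D}^{\oplus x}$, and let $\mathsf{Ch}_\mu(\mathcal{D})$ be the mean-limited channel whose transition rule maps a non-negative integer $x$ to a sample from $\mathcal{D}^{\oplus x}$. Then $$\mathsf{Cap}(\mathsf{Ch})\le\sup_{\mu\ge\overline{\lambda}}\frac{\mathsf{Cap}(\mathsf{Ch}_\mu(\mathcal{P}))}{1/p+(\mu-\overline{\lambda})/\lambda} \qquad\text{and}\qquad \mathsf{Cap}(\mathsf{Ch})\le\sup_{\mu\ge 0}\frac{\mathsf{Cap}(\mathsf{Ch}_\mu(\mathcal{D}))}{1/p+\mu/\lambda}.$$ -/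

import Mathlib

open scoped ENNReal NNReal

namespace RepeatChannel

noncomputable section

/-! A channel with discrete input alphabet `α` and discrete output alphabet `β` is a transition
rule `W : α → PMF β`. Information is measured in nats. -/

/-- Kullback-Leibler divergence between two discrete distributions. -/
def klDivergence {γ : Type*} (p q : PMF γ) : ℝ≥0∞ :=
  letI : MeasurableSpace γ := ⊤
  InformationTheory.klDiv p.toMeasure q.toMeasure

/-- The joint law of `(X, Y)`, where `X` has law `P` and, given `X = x`, `Y` has law `W x`. -/
def jointLaw {α β : Type*} (P : PMF α) (W : α → PMF β) : PMF (α × β) :=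
  P.bind fun x => (W x).map fun y => (x, y)

/-- The mutual information `I(X; Y)` between the input `X`, of law `P`, and the output `Y` of the
channel `W`: the divergence of the joint law from the product of the marginals. The law of `Y` is
`P.bind W`. -/
def mutualInfo {α β : Type*} (P : PMF α) (W : α → PMF β) : ℝ≥0∞ :=
  klDivergence (jointLaw P W) (jointLaw P fun _ => P.bind W)

/-- The expectation of a distribution on the non-negative integers. -/
def mean (D : PMF ℕ) : ℝ≥0∞ := ∑' k, D k * (k : ℝ≥0∞)

/-- The convolution `p ⊕ q`: the law of the sum of independent samples from `p` and `q`. -/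
def conv (p q : PMF ℕ) : PMF ℕ := p.bind fun a => q.map fun b => a + b

/-- The `x`-fold convolution `D^{⊕x}`. -/
def convPow (D : PMF ℕ) : ℕ → PMF ℕ
  | 0 => PMF.pure 0
  | x + 1 => conv D (convPow D x)

/-- The retention probability `p = 1 - D(0)`. -/
def retentionProb (D : PMF ℕ) : ℝ≥0∞ := 1 - D 0

theorem exists_mem_support_of_ne_one {D : PMF ℕ} (hD : D 0 ≠ 1) :
    ∃ k ∈ ({0}ᶜ : Set ℕ), k ∈ D.support := by
  by_contra! h
  apply hD
  rw [PMF.apply_eq_one_iff]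
  apply D.support_nonempty.subset_singleton_iff.mp
  intro k hk
  by_contra hk0
  exact h k hk0 hk

/-- The law `D` conditioned on the outcome being nonzero. -/
def condNonzero (D : PMF ℕ) (hD : D 0 ≠ 1) : PMF ℕ :=
  D.filter {0}ᶜ (exists_mem_support_of_ne_one hD)

/-- The `D`-repeat channel on finite bit strings: each bit is replaced, independently, by a number
of copies of itself drawn from `D`. -/
def repeatChannel (D : PMF ℕ) : List Bool → PMF (List Bool)
  | [] => PMF.pure []
  | b :: bs => D.bind fun k => (repeatChannel D bs).map fun ys => List.replicate k b ++ ys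

/-- The largest mutual information between an `n`-bit input of the `D`-repeat channel and the
corresponding output bit string. -/
def maxInfo (D : PMF ℕ) (n : ℕ) : ℝ≥0∞ :=
  ⨆ P : PMF (Fin n → Bool), mutualInfo P fun x => repeatChannel D (List.ofFn x)

/-- The capacity of the `D`-repeat channel, `lim_n sup_X I(X; Y) / n`. The upper limit is taken, so
that the existence of the limit is not presupposed. -/
def capacity (D : PMF ℕ) : ℝ≥0∞ :=
  Filter.limsup (fun n : ℕ => maxInfo D n / (n : ℝ≥0∞)) Filter.atTop

/-- The capacity of the mean-limited channel `Ch_μ(W)`: the supremum of `I(X; Y)` over all input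
laws whose output law has mean exactly `μ`. -/
def meanLimitedCapacity {α : Type*} (W : α → PMF ℕ) (μ : ℝ≥0) : ℝ≥0∞ :=
  ⨆ (P : PMF α) (_ : mean (P.bind W) = (μ : ℝ≥0∞)), mutualInfo P W

/-- The transition rule on positive integers that maps `1 + x` to `D̄ ⊕ D^{⊕x}`, where `D̄` is `D`
conditioned on being nonzero. -/
def runChannel (D : PMF ℕ) (hD : D 0 ≠ 1) (z : ℕ+) : PMF ℕ :=
  conv (condNonzero D hD) (convPow D ((z : ℕ) - 1))

/-- The convolution channel on non-negative integers, which maps `x` to `D^{⊕x}`. -/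
def convolutionChannel (D : PMF ℕ) (x : ℕ) : PMF ℕ := convPow D x

end

end RepeatChannel

namespace RepeatChannel

noncomputable section

/-! The output is cut into runs. The first retained bit of a run opens it and contributes a nonzero
number of copies. Each later input bit of the same value, before the next run opens, contributes an
independent sample of `D`, possibly zero; opposite bits in between are all deleted. If x such later
bits follow, call x the excess of the run. Given the first output bit and the list of excesses, the
run lengths are independent outputs of `excessChannel`, so the repeat channel is `runLaw` followed
by a memoryless channel (`repeatChannel_eq_runLaw_bind`).

Every input bit either belongs to an excess or is an attempt to open a run, which succeeds with
probability p. Hence (number of runs) / p + (total excess) has expectation exactly n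
(`tsum_runLaw_mul`).

Suppose an excess of finite mean e conveys at most S (1/p + e) through `excessChannel`. Comparing
with product reference laws, one for each first bit and run count, gives at most S n + log (2 (n +
1)) for n input bits (`maxInfo_le`), and the logarithm vanishes after division by n. Both suprema
are admissible values of S: the output mean is the mean of `condNonzero` plus e λ for
`excessChannel`, and e λ for `convolutionChannel`, while `excessChannel` is a degraded
`convolutionChannel`. -/

/-! ### Pointwise Kullback-Leibler terms. -/

/-- The contribution `a log (a / b) + b - a` of a point with masses `a` and `b` to the
Kullback-Leibler divergence. -/
def klTerm (a b : ℝ≥0∞) : ℝ≥0∞ :=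
  if b = 0 then (if a = 0 then 0 else ∞)
  else ENNReal.ofReal (a.toReal * Real.log (a.toReal / b.toReal) + b.toReal - a.toReal)

theorem klTerm_zero_zero : klTerm 0 0 = 0 := by simp [klTerm]

theorem klTerm_zero_right {a : ℝ≥0∞} (ha : a ≠ 0) : klTerm a 0 = ∞ := by simp [klTerm, ha]

theorem klTerm_of_ne_zero (a : ℝ≥0∞) {b : ℝ≥0∞} (hb : b ≠ 0) :
    klTerm a b =
      ENNReal.ofReal (a.toReal * Real.log (a.toReal / b.toReal) + b.toReal - a.toReal) := by
  simp [klTerm, hb]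

theorem klTerm_zero_left {b : ℝ≥0∞} (hb : b ≠ ∞) : klTerm 0 b = b := by
  by_cases h : b = 0
  · simp [klTerm, h]
  · simp [klTerm, h, hb]

theorem klTerm_eq_mul_klFun {a b : ℝ≥0∞} (hb : b ≠ 0) (hb' : b ≠ ∞) :
    klTerm a b = b * ENNReal.ofReal (InformationTheory.klFun (a / b).toReal) := by
  have hb0 : 0 < b.toReal := ENNReal.toReal_pos hb hb'
  rw [klTerm_of_ne_zero a hb, ← ENNReal.ofReal_toReal hb', ← ENNReal.ofReal_mul hb0.le,
    ENNReal.toReal_ofReal hb0.le, ENNReal.ofReal_toReal hb', ENNReal.toReal_div,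
    InformationTheory.klFun_apply]
  congr 1
  field_simp

/-- The real expression of `klTerm` is nonnegative. -/
theorem mul_log_add_sub_nonneg {a b : ℝ} (ha : 0 ≤ a) (hb : 0 < b) :
    0 ≤ a * Real.log (a / b) + b - a := by
  have h := InformationTheory.klFun_nonneg (div_nonneg ha hb.le)
  have h2 : a * Real.log (a / b) + b - a = b * InformationTheory.klFun (a / b) := by
    rw [InformationTheory.klFun_apply]; field_simp
  rw [h2]
  positivity

/-- The variational lower bound on `klTerm`. -/
theorem ofReal_le_klTerm {a b : ℝ≥0∞} (ha : a ≠ ∞) (hb : b ≠ ∞) (t : ℝ) :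
    ENNReal.ofReal (a.toReal * t - b.toReal * (Real.exp t - 1)) ≤ klTerm a b := by
  by_cases hb0 : b = 0
  · by_cases ha0 : a = 0
    · simp [ha0, hb0]
    · simp [hb0, klTerm_zero_right ha0]
  · rw [klTerm_of_ne_zero a hb0]
    apply ENNReal.ofReal_le_ofReal
    have hb1 : 0 < b.toReal := ENNReal.toReal_pos hb0 hb
    by_cases ha0 : a = 0
    · have := Real.exp_pos t
      simp only [ha0, ENNReal.toReal_zero]
      nlinarith
    · have ha1 : 0 < a.toReal := ENNReal.toReal_pos ha0 ha
      -- `L` is the maximizing `t`; the claim becomes `1 + (t - L) ≤ exp (t - L)`, scaled by the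
      -- mass `a`.
      set L := Real.log (a.toReal / b.toReal) with hL
      have h1 : b.toReal * Real.exp t = a.toReal * Real.exp (t - L) := by
        rw [Real.exp_sub, hL, Real.exp_log (by positivity)]
        field_simp
      have h2 := Real.add_one_le_exp (t - L)
      have h3 := mul_le_mul_of_nonneg_left h2 ha1.le
      linarith

theorem ofReal_tsum_le {ι : Type*} {f : ι → ℝ} (hf : Summable f) :
    ENNReal.ofReal (∑' i, f i) ≤ ∑' i, ENNReal.ofReal (f i) := by
  have h1 : Summable fun i => |f i| := hf.abs
  have h2 : Summable fun i => max (f i) 0 :=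
    h1.of_nonneg_of_le (fun i => le_max_right _ _) fun i => max_le (le_abs_self _) (abs_nonneg _)
  calc ENNReal.ofReal (∑' i, f i) ≤ ENNReal.ofReal (∑' i, max (f i) 0) :=
        ENNReal.ofReal_le_ofReal (hf.tsum_le_tsum (fun i => le_max_left _ _) h2)
    _ = ∑' i, ENNReal.ofReal (max (f i) 0) :=
        ENNReal.ofReal_tsum_of_nonneg (fun i => le_max_right _ _) h2
    _ = ∑' i, ENNReal.ofReal (f i) := by
        refine tsum_congr fun i => ?_
        rcases le_total (f i) 0 with h | h
        · simp [h, ENNReal.ofReal_of_nonpos h]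
        · simp [h]

/-- The log-sum inequality. The variational bound `ofReal_le_klTerm` is linear in the masses, so the
`t` that is optimal for the totals can be used in every term and the bounds summed. -/
theorem klTerm_tsum_le {ι : Type*} (a b : ι → ℝ≥0∞) (ha : ∑' i, a i ≠ ∞) (hb : ∑' i, b i ≠ ∞) :
    klTerm (∑' i, a i) (∑' i, b i) ≤ ∑' i, klTerm (a i) (b i) := by
  have ha' := ENNReal.ne_top_of_tsum_ne_top ha
  have hb' := ENNReal.ne_top_of_tsum_ne_top hb
  by_cases hA : ∑' i, a i = 0
  · have hai : ∀ i, a i = 0 := ENNReal.tsum_eq_zero.1 hA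
    rw [hA, klTerm_zero_left hb]
    exact (tsum_congr fun i => by rw [hai i, klTerm_zero_left (hb' i)]).ge
  by_cases hB : ∑' i, b i = 0
  · have hbi : ∀ i, b i = 0 := ENNReal.tsum_eq_zero.1 hB
    obtain ⟨i, hi⟩ : ∃ i, a i ≠ 0 := by
      by_contra! h
      exact hA (ENNReal.tsum_eq_zero.2 h)
    have h : klTerm (a i) (b i) = ∞ := by rw [hbi i, klTerm_zero_right hi]
    exact le_top.trans_eq (ENNReal.tsum_eq_top_of_eq_top ⟨i, h⟩).symm
  set A := (∑' i, a i).toReal with hAdef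
  set B := (∑' i, b i).toReal with hBdef
  have hA0 : 0 < A := ENNReal.toReal_pos hA ha
  have hB0 : 0 < B := ENNReal.toReal_pos hB hb
  set t := Real.log (A / B) with ht
  have het : B * Real.exp t = A := by
    rw [ht, Real.exp_log (by positivity)]; field_simp
  have hsa : Summable fun i => (a i).toReal := ENNReal.summable_toReal ha
  have hsb : Summable fun i => (b i).toReal := ENNReal.summable_toReal hb
  calc klTerm (∑' i, a i) (∑' i, b i)
      = ENNReal.ofReal (A * t - B * (Real.exp t - 1)) := by
        rw [klTerm_of_ne_zero _ hB]
        congr 1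
        linarith
    _ = ENNReal.ofReal (∑' i, ((a i).toReal * t - (b i).toReal * (Real.exp t - 1))) := by
        rw [(hsa.mul_right t).tsum_sub (hsb.mul_right _), tsum_mul_right, tsum_mul_right,
          ← ENNReal.tsum_toReal_eq ha', ← ENNReal.tsum_toReal_eq hb']
    _ ≤ ∑' i, ENNReal.ofReal ((a i).toReal * t - (b i).toReal * (Real.exp t - 1)) :=
        ofReal_tsum_le ((hsa.mul_right t).sub (hsb.mul_right _))
    _ ≤ ∑' i, klTerm (a i) (b i) :=
        ENNReal.tsum_le_tsum fun i => ofReal_le_klTerm (ha' i) (hb' i) t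

theorem klTerm_mul_left {c : ℝ≥0∞} (hc : c ≠ ∞) (a b : ℝ≥0∞) :
    klTerm (c * a) (c * b) = c * klTerm a b := by
  by_cases hc0 : c = 0
  · simp [hc0, klTerm_zero_zero]
  by_cases hb : b = 0
  · by_cases ha : a = 0
    · simp [ha, hb, klTerm_zero_zero]
    · rw [hb, mul_zero, klTerm_zero_right ha, klTerm_zero_right (mul_ne_zero hc0 ha),
        ENNReal.mul_top hc0]
  · have hc1 : 0 < c.toReal := ENNReal.toReal_pos hc0 hc
    rw [klTerm_of_ne_zero _ hb, klTerm_of_ne_zero _ (mul_ne_zero hc0 hb), ENNReal.toReal_mul,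
      ENNReal.toReal_mul, mul_div_mul_left _ _ hc1.ne']
    conv_rhs => rw [← ENNReal.ofReal_toReal hc, ← ENNReal.ofReal_mul hc1.le]
    congr 1
    ring

theorem klTerm_mul_right {c : ℝ≥0∞} (hc : c ≠ ∞) (a b : ℝ≥0∞) :
    klTerm (a * c) (b * c) = klTerm a b * c := by
  rw [mul_comm a, mul_comm b, klTerm_mul_left hc, mul_comm]

/-- Additivity of `klTerm` over products, up to terms that cancel after summation. -/
theorem klTerm_mul_mul {a b c d : ℝ≥0∞} (ha : a ≠ ∞) (hb : b ≠ ∞) (hc : c ≠ ∞) (hd : d ≠ ∞) :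
    klTerm (a * c) (b * d) + (b * c + a * d) =
      klTerm a b * c + a * klTerm c d + (b * d + a * c) := by
  by_cases hc0 : c = 0
  · subst hc0
    simp only [mul_zero, zero_add, add_zero]
    rw [klTerm_zero_left (ENNReal.mul_ne_top hb hd), klTerm_zero_left hd, add_comm]
  by_cases ha0 : a = 0
  · subst ha0
    simp only [zero_mul, add_zero]
    rw [klTerm_zero_left (ENNReal.mul_ne_top hb hd), klTerm_zero_left hb, add_comm]
  by_cases hb0 : b = 0
  · rw [hb0, zero_mul, klTerm_zero_right ha0, klTerm_zero_right (mul_ne_zero ha0 hc0),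
      ENNReal.top_mul hc0]
    simp
  by_cases hd0 : d = 0
  · rw [hd0, mul_zero, klTerm_zero_right hc0, klTerm_zero_right (mul_ne_zero ha0 hc0),
      ENNReal.mul_top ha0]
    simp
  lift a to ℝ≥0 using ha
  lift b to ℝ≥0 using hb
  lift c to ℝ≥0 using hc
  lift d to ℝ≥0 using hd
  have ha1 : (0 : ℝ) < a := by exact_mod_cast pos_iff_ne_zero.2 (by simpa using ha0)
  have hb1 : (0 : ℝ) < b := by exact_mod_cast pos_iff_ne_zero.2 (by simpa using hb0)
  have hc1 : (0 : ℝ) < c := by exact_mod_cast pos_iff_ne_zero.2 (by simpa using hc0)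
  have hd1 : (0 : ℝ) < d := by exact_mod_cast pos_iff_ne_zero.2 (by simpa using hd0)
  rw [klTerm_of_ne_zero _ hb0, klTerm_of_ne_zero _ hd0, klTerm_of_ne_zero _ (mul_ne_zero hb0 hd0)]
  have h1 := mul_log_add_sub_nonneg ha1.le hb1
  have h2 := mul_log_add_sub_nonneg hc1.le hd1
  have h3 := mul_log_add_sub_nonneg (mul_pos ha1 hc1).le (mul_pos hb1 hd1)
  rw [← ENNReal.toReal_eq_toReal_iff' (by finiteness) (by finiteness)]
  simp only [ENNReal.toReal_mul, ENNReal.coe_toReal]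
  rw [ENNReal.toReal_add (by finiteness) (by finiteness),
    ENNReal.toReal_add (by finiteness) (by finiteness),
    ENNReal.toReal_add (by finiteness) (by finiteness),
    ENNReal.toReal_add (by finiteness) (by finiteness),
    ENNReal.toReal_add (by finiteness) (by finiteness)]
  simp only [ENNReal.toReal_mul, ENNReal.coe_toReal, ENNReal.toReal_ofReal h1,
    ENNReal.toReal_ofReal h2, ENNReal.toReal_ofReal h3]
  rw [mul_div_mul_comm, Real.log_mul (by positivity) (by positivity)]
  ring

/-- Changing the reference mass by a bounded factor. -/
theorem klTerm_le_of_mul_le {a b B : ℝ≥0∞} {M : ℝ} (ha : a ≠ ∞) (hb : b ≠ ∞) (hB : B ≠ ∞)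
    (hM : 1 ≤ M) (h : b ≤ ENNReal.ofReal M * B) :
    klTerm a B + b ≤ klTerm a b + a * ENNReal.ofReal (Real.log M) + B := by
  by_cases ha0 : a = 0
  · subst ha0
    rw [klTerm_zero_left hb, klTerm_zero_left hB, zero_mul, add_zero, add_comm]
  by_cases hb0 : b = 0
  · rw [hb0, klTerm_zero_right ha0]; simp
  have hB0 : B ≠ 0 := by
    rintro rfl
    simp at h
    exact hb0 h
  lift a to ℝ≥0 using ha
  lift b to ℝ≥0 using hb
  lift B to ℝ≥0 using hB
  have ha1 : (0 : ℝ) < a := by exact_mod_cast pos_iff_ne_zero.2 (by simpa using ha0)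
  have hb1 : (0 : ℝ) < b := by exact_mod_cast pos_iff_ne_zero.2 (by simpa using hb0)
  have hB1 : (0 : ℝ) < B := by exact_mod_cast pos_iff_ne_zero.2 (by simpa using hB0)
  have h' : (b : ℝ) ≤ M * B := by
    have := ENNReal.toReal_mono (by finiteness) h
    rwa [ENNReal.toReal_mul, ENNReal.toReal_ofReal (by linarith)] at this
  rw [klTerm_of_ne_zero _ hb0, klTerm_of_ne_zero _ hB0]
  have h1 := mul_log_add_sub_nonneg ha1.le hb1
  have h2 := mul_log_add_sub_nonneg ha1.le hB1
  have hlog : 0 ≤ Real.log M := Real.log_nonneg hM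
  rw [← ENNReal.toReal_le_toReal (by finiteness) (by finiteness)]
  rw [ENNReal.toReal_add (by finiteness) (by finiteness),
    ENNReal.toReal_add (by finiteness) (by finiteness),
    ENNReal.toReal_add (by finiteness) (by finiteness)]
  simp only [ENNReal.toReal_mul, ENNReal.coe_toReal, ENNReal.toReal_ofReal h1,
    ENNReal.toReal_ofReal h2, ENNReal.toReal_ofReal hlog]
  have h3 : Real.log b ≤ Real.log M + Real.log B := by
    rw [← Real.log_mul (by positivity) (by positivity)]
    exact Real.log_le_log hb1 h'
  rw [Real.log_div ha1.ne' hb1.ne', Real.log_div ha1.ne' hB1.ne']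
  nlinarith

/-! ### Discrete divergence and mutual information. -/

/-- Under absolute continuity the density is `p x / q x`. The summands are nonnegative, so no
integrability is needed; otherwise one term is already infinite. -/
theorem klDivergence_eq_tsum {γ : Type*} [Countable γ] (p q : PMF γ) :
    klDivergence p q = ∑' x, klTerm (p x) (q x) := by
  let _ : MeasurableSpace γ := ⊤
  change InformationTheory.klDiv p.toMeasure q.toMeasure = _
  by_cases h : ∀ x, q x = 0 → p x = 0
  · have hd : p.toMeasure = q.toMeasure.withDensity fun x => p x / q x := by
      refine MeasureTheory.Measure.ext_of_singleton fun x => ?_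
      rw [MeasureTheory.withDensity_apply _ (MeasurableSet.singleton x),
        MeasureTheory.lintegral_singleton, PMF.toMeasure_apply_singleton _ _ (MeasurableSet.singleton _),
        PMF.toMeasure_apply_singleton _ _ (MeasurableSet.singleton _)]
      by_cases hq : q x = 0
      · simp [hq, h x hq]
      · exact (ENNReal.div_mul_cancel hq (q.apply_ne_top x)).symm
    have hac : p.toMeasure.AbsolutelyContinuous q.toMeasure := by
      rw [hd]; exact MeasureTheory.withDensity_absolutelyContinuous _ _
    have hr : p.toMeasure.rnDeriv q.toMeasure =ᵐ[q.toMeasure] fun x => p x / q x := by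
      conv_lhs => rw [hd]
      exact MeasureTheory.Measure.rnDeriv_withDensity _ (measurable_of_countable _)
    rw [InformationTheory.klDiv_eq_lintegral_klFun_of_ac hac,
      MeasureTheory.lintegral_congr_ae (g := fun x =>
        ENNReal.ofReal (InformationTheory.klFun (p x / q x).toReal))
        (by filter_upwards [hr] with x hx; rw [hx]),
      MeasureTheory.lintegral_countable']
    refine tsum_congr fun x => ?_
    rw [PMF.toMeasure_apply_singleton _ _ (MeasurableSet.singleton _)]
    by_cases hq : q x = 0
    · simp [hq, h x hq, klTerm_zero_zero]
    · rw [klTerm_eq_mul_klFun hq (q.apply_ne_top x), mul_comm]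
  · push Not at h
    obtain ⟨x, hq, hp⟩ := h
    rw [InformationTheory.klDiv_of_not_ac, ENNReal.tsum_eq_top_of_eq_top ⟨x, by
      rw [hq, klTerm_zero_right hp]⟩]
    intro hac
    have := hac (s := {x}) (by rw [PMF.toMeasure_apply_singleton _ _ (MeasurableSet.singleton _), hq])
    rw [PMF.toMeasure_apply_singleton _ _ (MeasurableSet.singleton _)] at this
    exact hp this

theorem tsum_bind_mul {α β : Type*} (P : PMF α) (K : α → PMF β) (f : β → ℝ≥0∞) :
    ∑' y, P.bind K y * f y = ∑' x, P x * ∑' y, K x y * f y := by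
  simp_rw [PMF.bind_apply, ← ENNReal.tsum_mul_right, ← ENNReal.tsum_mul_left]
  rw [ENNReal.tsum_comm]
  simp_rw [mul_assoc]

theorem tsum_pure_mul {α : Type*} (a : α) (f : α → ℝ≥0∞) : ∑' x, PMF.pure a x * f x = f a := by
  rw [tsum_eq_single a]
  · simp
  · intro b hb
    simp [PMF.pure_apply, hb]

theorem tsum_map_mul {α β : Type*} (P : PMF α) (g : α → β) (f : β → ℝ≥0∞) :
    ∑' y, P.map g y * f y = ∑' x, P x * f (g x) := by
  rw [PMF.map, tsum_bind_mul]
  simp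

theorem tsum_mul_le_of_support {α : Type*} (P : PMF α) {f g : α → ℝ≥0∞}
    (h : ∀ x ∈ P.support, f x ≤ g x) : ∑' x, P x * f x ≤ ∑' x, P x * g x := by
  refine ENNReal.tsum_le_tsum fun x => ?_
  by_cases hx : P x = 0
  · simp [hx]
  · exact mul_le_mul_right (h x hx) _

theorem tsum_mul_const {α : Type*} (P : PMF α) (c : ℝ≥0∞) : ∑' x, P x * c = c := by
  rw [ENNReal.tsum_mul_right, P.tsum_coe, one_mul]

/-- Data processing inequality. -/
theorem klDivergence_bind_bind_le {α β : Type*} [Countable α] [Countable β] (p q : PMF α)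
    (K : α → PMF β) : klDivergence (p.bind K) (q.bind K) ≤ klDivergence p q := by
  rw [klDivergence_eq_tsum, klDivergence_eq_tsum]
  calc ∑' y, klTerm (p.bind K y) (q.bind K y)
      ≤ ∑' y, ∑' x, klTerm (p x * K x y) (q x * K x y) :=
        ENNReal.tsum_le_tsum fun y => klTerm_tsum_le _ _ ((p.bind K).apply_ne_top y)
          ((q.bind K).apply_ne_top y)
    _ = ∑' x, ∑' y, klTerm (p x) (q x) * K x y := by
        rw [ENNReal.tsum_comm]
        simp_rw [klTerm_mul_right ((K _).apply_ne_top _)]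
    _ = ∑' x, klTerm (p x) (q x) := by
        simp_rw [ENNReal.tsum_mul_left, PMF.tsum_coe, mul_one]

theorem klDivergence_map_map_le {α β : Type*} [Countable α] [Countable β] (p q : PMF α)
    (f : α → β) : klDivergence (p.map f) (q.map f) ≤ klDivergence p q :=
  klDivergence_bind_bind_le p q _

/-- Convexity of the divergence in its first argument. -/
theorem klDivergence_bind_le {α β : Type*} [Countable α] [Countable β] (P : PMF α)
    (W : α → PMF β) (Q : PMF β) :
    klDivergence (P.bind W) Q ≤ ∑' x, P x * klDivergence (W x) Q := by
  simp_rw [klDivergence_eq_tsum]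
  calc ∑' y, klTerm (P.bind W y) (Q y)
      ≤ ∑' y, ∑' x, klTerm (P x * W x y) (P x * Q y) := by
        refine ENNReal.tsum_le_tsum fun y => ?_
        have h : Q y = ∑' x, P x * Q y := (tsum_mul_const P _).symm
        conv_lhs => rw [h]
        exact klTerm_tsum_le _ _ ((P.bind W).apply_ne_top y) (h ▸ Q.apply_ne_top y)
    _ = ∑' x, ∑' y, P x * klTerm (W x y) (Q y) := by
        rw [ENNReal.tsum_comm]
        simp_rw [klTerm_mul_left (P.apply_ne_top _)]
    _ = ∑' x, P x * ∑' y, klTerm (W x y) (Q y) := by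
        simp_rw [ENNReal.tsum_mul_left]

theorem jointLaw_apply {α β : Type*} (P : PMF α) (W : α → PMF β) (x : α) (y : β) :
    jointLaw P W (x, y) = P x * W x y := by
  classical
  rw [jointLaw, PMF.bind_apply, tsum_eq_single x]
  · rw [PMF.map_apply, tsum_eq_single y]
    · simp
    · intro y' hy'
      simp [Ne.symm hy']
  · intro x' hx'
    rw [PMF.map_apply]
    simp [Ne.symm hx']

/-- The mutual information is the average divergence of the transition laws from the output law. -/
theorem mutualInfo_eq_tsum {α β : Type*} [Countable α] [Countable β] (P : PMF α)
    (W : α → PMF β) : mutualInfo P W = ∑' x, P x * klDivergence (W x) (P.bind W) := by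
  rw [mutualInfo, klDivergence_eq_tsum, ENNReal.tsum_prod']
  simp_rw [jointLaw_apply, klTerm_mul_left (P.apply_ne_top _), ENNReal.tsum_mul_left,
    klDivergence_eq_tsum]

/-- The compensation identity at one output letter: when the average m of `w` and `q` are nonzero,
the right side is the left side plus `klTerm m q`. -/
theorem tsum_mul_klTerm_le {α : Type*} (P : PMF α) (w : α → ℝ≥0∞) (hw : ∀ x, w x ≤ 1)
    {q : ℝ≥0∞} (hq : q ≠ ∞) :
    ∑' x, P x * klTerm (w x) (∑' x, P x * w x) ≤ ∑' x, P x * klTerm (w x) q := by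
  set m := ∑' x, P x * w x with hm
  have hm1 : m ≤ 1 := by
    calc m ≤ ∑' x, P x * 1 := ENNReal.tsum_le_tsum fun x => mul_le_mul_right (hw x) _
      _ = 1 := tsum_mul_const P 1
  have hmt : m ≠ ∞ := ne_top_of_le_ne_top ENNReal.one_ne_top hm1
  have hwt : ∀ x, w x ≠ ∞ := fun x => ne_top_of_le_ne_top ENNReal.one_ne_top (hw x)
  by_cases hm0 : m = 0
  · have h : ∀ x, P x * w x = 0 := ENNReal.tsum_eq_zero.1 hm0
    refine ENNReal.tsum_le_tsum fun x => ?_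
    rcases mul_eq_zero.1 (h x) with h | h
    · simp [h]
    · simp [h, hm0, klTerm_zero_zero]
  by_cases hq0 : q = 0
  · obtain ⟨x, hx⟩ : ∃ x, P x * w x ≠ 0 := by
      by_contra! h
      exact hm0 (ENNReal.tsum_eq_zero.2 h)
    have h : P x * klTerm (w x) q = ∞ := by
      rw [hq0, klTerm_zero_right (right_ne_zero_of_mul hx),
        ENNReal.mul_top (left_ne_zero_of_mul hx)]
    exact le_top.trans_eq (ENNReal.tsum_eq_top_of_eq_top ⟨x, h⟩).symm
  have hm2 : 0 < m.toReal := ENNReal.toReal_pos hm0 hmt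
  have hq2 : 0 < q.toReal := ENNReal.toReal_pos hq0 hq
  set L := Real.log (m.toReal / q.toReal) with hL
  -- The sign of `L` is unknown; its positive and negative parts let `key` be stated without
  -- subtraction in `ℝ≥0∞`.
  set u := ENNReal.ofReal L
  set v := ENNReal.ofReal (-L)
  have huv : u.toReal - v.toReal = L := by
    simp only [u, v, ENNReal.toReal_ofReal']
    rcases le_total L 0 with h | h
    · simp [h]
    · simp [h]
  have key : ∀ x, klTerm (w x) m + (w x * u + q) = klTerm (w x) q + (w x * v + m) := by
    intro x
    have hwx := hwt x
    have hu : u ≠ ∞ := ENNReal.ofReal_ne_top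
    have hv : v ≠ ∞ := ENNReal.ofReal_ne_top
    rw [klTerm_of_ne_zero _ hm0, klTerm_of_ne_zero _ hq0,
      ← ENNReal.toReal_eq_toReal_iff' (by finiteness) (by finiteness),
      ENNReal.toReal_add (by finiteness) (by finiteness),
      ENNReal.toReal_add (by finiteness) (by finiteness),
      ENNReal.toReal_add (by finiteness) (by finiteness),
      ENNReal.toReal_add (by finiteness) (by finiteness),
      ENNReal.toReal_ofReal (mul_log_add_sub_nonneg ENNReal.toReal_nonneg hm2),
      ENNReal.toReal_ofReal (mul_log_add_sub_nonneg ENNReal.toReal_nonneg hq2),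
      ENNReal.toReal_mul, ENNReal.toReal_mul]
    by_cases hw0 : w x = 0
    · simp [hw0]; ring
    · have hw1 : 0 < (w x).toReal := ENNReal.toReal_pos hw0 hwx
      have : Real.log ((w x).toReal / q.toReal) = Real.log ((w x).toReal / m.toReal) + L := by
        rw [hL, ← Real.log_mul (by positivity) (by positivity)]
        congr 1
        field_simp
      rw [this, ← huv]
      ring
  have hsum : ∑' x, P x * klTerm (w x) m + (m * u + q) =
      ∑' x, P x * klTerm (w x) q + (m * v + m) := by
    have h := tsum_congr (L := .unconditional _) fun x => congrArg (P x * ·) (key x)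
    simp only [mul_add, ENNReal.tsum_add, tsum_mul_const, ← mul_assoc, ENNReal.tsum_mul_right] at h
    rwa [← hm] at h
  -- This is the nonnegativity of `m log (m / q) + q - m`.
  have hle : m * v + m ≤ m * u + q := by
    have hu : u ≠ ∞ := ENNReal.ofReal_ne_top
    have hv : v ≠ ∞ := ENNReal.ofReal_ne_top
    rw [← ENNReal.toReal_le_toReal (by finiteness) (by finiteness),
      ENNReal.toReal_add (by finiteness) (by finiteness),
      ENNReal.toReal_add (by finiteness) (by finiteness), ENNReal.toReal_mul, ENNReal.toReal_mul]
    have := mul_log_add_sub_nonneg hm2.le hq2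
    rw [← hL, ← huv] at this
    linarith
  have hfin : m * u + q ≠ ∞ := by
    have hu : u ≠ ∞ := ENNReal.ofReal_ne_top
    finiteness
  exact (ENNReal.add_le_add_iff_right hfin).1 (hsum.trans_le (add_le_add_right hle _))

/-- The average divergence of the transition laws from any fixed law bounds the mutual
information. -/
theorem mutualInfo_le_tsum {α β : Type*} [Countable α] [Countable β] (P : PMF α)
    (W : α → PMF β) (Q : PMF β) : mutualInfo P W ≤ ∑' x, P x * klDivergence (W x) Q := by
  rw [mutualInfo_eq_tsum]
  simp_rw [klDivergence_eq_tsum, ← ENNReal.tsum_mul_left]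
  rw [ENNReal.tsum_comm, ENNReal.tsum_comm (f := fun x y => P x * klTerm (W x y) (Q y))]
  exact ENNReal.tsum_le_tsum fun y =>
    tsum_mul_klTerm_le P (fun x => W x y) (fun x => (W x).coe_le_one y) (Q.apply_ne_top y)

/-! ### Product laws, change of reference law, disintegration. -/

/-- The law of a pair of independent samples. -/
def prodLaw {α β : Type*} (p : PMF α) (q : PMF β) : PMF (α × β) := jointLaw p fun _ => q

/-- The correction terms in `klTerm_mul_mul` are masses of product laws. They sum to 2 on each side
and cancel, even when a divergence is infinite. -/
theorem klDivergence_prodLaw {α β : Type*} [Countable α] [Countable β] (p r : PMF α)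
    (q s : PMF β) :
    klDivergence (prodLaw p q) (prodLaw r s) = klDivergence p r + klDivergence q s := by
  have h : ∀ z : α × β, klTerm (prodLaw p q z) (prodLaw r s z) +
      (prodLaw r q z + prodLaw p s z) = klTerm (p z.1) (r z.1) * q z.2 +
        p z.1 * klTerm (q z.2) (s z.2) + (prodLaw r s z + prodLaw p q z) := by
    rintro ⟨x, y⟩
    simp only [prodLaw, jointLaw_apply]
    exact klTerm_mul_mul (p.apply_ne_top x) (r.apply_ne_top x) (q.apply_ne_top y)
      (s.apply_ne_top y)
  have h2 := tsum_congr (L := .unconditional _) h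
  simp only [ENNReal.tsum_add, PMF.tsum_coe] at h2
  rw [ENNReal.add_left_inj (by finiteness)] at h2
  rw [klDivergence_eq_tsum, h2, ENNReal.tsum_prod', ENNReal.tsum_prod', klDivergence_eq_tsum,
    klDivergence_eq_tsum]
  simp_rw [ENNReal.tsum_mul_left, ENNReal.tsum_mul_right, PMF.tsum_coe, mul_one, one_mul]

theorem klDivergence_le_add_log {α : Type*} [Countable α] (p q Q : PMF α) {M : ℝ} (hM : 1 ≤ M)
    (h : ∀ x, q x ≤ ENNReal.ofReal M * Q x) :
    klDivergence p Q ≤ klDivergence p q + ENNReal.ofReal (Real.log M) := by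
  have h1 := ENNReal.tsum_le_tsum fun x => klTerm_le_of_mul_le (p.apply_ne_top x)
    (q.apply_ne_top x) (Q.apply_ne_top x) hM (h x)
  simp only [ENNReal.tsum_add, PMF.tsum_coe, tsum_mul_const] at h1
  rw [klDivergence_eq_tsum, klDivergence_eq_tsum]
  exact (ENNReal.add_le_add_iff_right ENNReal.one_ne_top).1 h1

/-- A discrete law disintegrates along any map. -/
theorem exists_disintegration {α β : Type*} (L : PMF α) (g : α → β) :
    ∃ κ : β → PMF α, (L.map g).bind κ = L ∧
      ∀ b ∈ (L.map g).support, ∀ a ∈ (κ b).support, g a = b := by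
  classical
  have hs : ∀ b ∈ (L.map g).support, ∃ a ∈ g ⁻¹' {b}, a ∈ L.support := by
    intro b hb
    obtain ⟨a, ha, hab⟩ := (PMF.mem_support_map_iff g L b).1 hb
    exact ⟨a, hab, ha⟩
  -- Off the support the kernel has weight zero, and `L` is only a filler.
  refine ⟨fun b => if hb : b ∈ (L.map g).support then L.filter (g ⁻¹' {b}) (hs b hb) else L,
    ?_, ?_⟩
  · ext a
    rw [PMF.bind_apply, tsum_eq_single (g a)]
    · by_cases ha : L a = 0
      · rw [ha]
        split_ifs with hb
        · rw [PMF.filter_apply]; simp [ha]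
        · rw [ha, mul_zero]
      · have hb : g a ∈ (L.map g).support :=
          (PMF.mem_support_map_iff g L _).2 ⟨a, ha, rfl⟩
        rw [dif_pos hb, PMF.filter_apply]
        have h1 : ∑' a', (g ⁻¹' {g a}).indicator L a' = L.map g (g a) := by
          rw [PMF.map_apply]
          refine tsum_congr fun a' => ?_
          simp [Set.indicator_apply, eq_comm]
        rw [h1, Set.indicator_of_mem (by simp), mul_comm (L a), ← mul_assoc,
          ENNReal.mul_inv_cancel hb ((L.map g).apply_ne_top _), one_mul]
    · intro b hb
      by_cases hb' : b ∈ (L.map g).support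
      · rw [dif_pos hb', PMF.filter_apply_eq_zero_of_notMem, mul_zero]
        exact fun h => hb h.symm
      · rw [(PMF.apply_eq_zero_iff _ _).2 hb', zero_mul]
  · intro b hb a ha
    simp only [dif_pos hb] at ha
    exact ((PMF.mem_support_filter_iff (hs b hb)).1 ha).1

/-! ### Retention, conditioning on nonzero, means of convolutions. -/

theorem retentionProb_ne_zero {D : PMF ℕ} (hD : D 0 ≠ 1) : retentionProb D ≠ 0 :=
  (tsub_pos_of_lt (lt_of_le_of_ne (D.coe_le_one 0) hD)).ne'

theorem retentionProb_ne_top (D : PMF ℕ) : retentionProb D ≠ ∞ :=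
  ne_top_of_le_ne_top ENNReal.one_ne_top tsub_le_self

theorem tsum_succ_eq_retentionProb (D : PMF ℕ) : ∑' k, D (k + 1) = retentionProb D := by
  have h := D.tsum_coe
  rw [tsum_eq_zero_add' ENNReal.summable] at h
  rw [retentionProb, ← h, ENNReal.add_sub_cancel_left (D.apply_ne_top 0)]

theorem add_retentionProb (D : PMF ℕ) : D 0 + retentionProb D = 1 :=
  add_tsub_cancel_of_le (D.coe_le_one 0)

theorem tsum_mul_ite_zero (D : PMF ℕ) (a b : ℝ≥0∞) :
    ∑' k, D k * (if k = 0 then a else b) = D 0 * a + retentionProb D * b := by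
  rw [tsum_eq_zero_add' ENNReal.summable]
  simp [ENNReal.tsum_mul_right, tsum_succ_eq_retentionProb]

theorem condNonzero_zero {D : PMF ℕ} (hD : D 0 ≠ 1) : condNonzero D hD 0 = 0 :=
  PMF.filter_apply_eq_zero_of_notMem _ (by simp)

theorem condNonzero_succ {D : PMF ℕ} (hD : D 0 ≠ 1) (k : ℕ) :
    condNonzero D hD (k + 1) = D (k + 1) * (retentionProb D)⁻¹ := by
  rw [condNonzero, PMF.filter_apply, Set.indicator_of_mem (by simp),
    ← tsum_succ_eq_retentionProb, tsum_eq_zero_add' ENNReal.summable]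
  simp

theorem tsum_mul_eq_condNonzero {D : PMF ℕ} (hD : D 0 ≠ 1) (f : ℕ → ℝ≥0∞) :
    ∑' k, D k * f k = D 0 * f 0 + retentionProb D * ∑' k, condNonzero D hD k * f k := by
  rw [tsum_eq_zero_add' ENNReal.summable,
    tsum_eq_zero_add' (f := fun k => condNonzero D hD k * f k) ENNReal.summable,
    condNonzero_zero, zero_mul, zero_add, ← ENNReal.tsum_mul_left]
  congr 1
  refine tsum_congr fun k => ?_
  rw [condNonzero_succ, mul_comm (D (k + 1)) _⁻¹, ← mul_assoc, ← mul_assoc,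
    ENNReal.mul_inv_cancel (retentionProb_ne_zero hD) (retentionProb_ne_top D), one_mul]

/-- A sample is zero or is a sample of the law conditioned on being nonzero. -/
theorem bind_eq_bind_ite_condNonzero {β : Type*} {D : PMF ℕ} (hD : D 0 ≠ 1) (f : ℕ → PMF β) :
    D.bind f = D.bind fun k => if k = 0 then f 0 else (condNonzero D hD).bind f := by
  ext y
  have h : ∀ k, (if k = 0 then f 0 else (condNonzero D hD).bind f) y =
      if k = 0 then f 0 y else (condNonzero D hD).bind f y := fun k => by split_ifs <;> rfl
  rw [PMF.bind_apply, PMF.bind_apply]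
  simp_rw [h]
  rw [tsum_mul_ite_zero, tsum_mul_eq_condNonzero hD, PMF.bind_apply]

theorem mean_eq_retentionProb_mul {D : PMF ℕ} (hD : D 0 ≠ 1) :
    mean D = retentionProb D * mean (condNonzero D hD) := by
  rw [mean, tsum_mul_eq_condNonzero hD]
  simp [mean]

theorem mean_ne_zero {D : PMF ℕ} (hD : D 0 ≠ 1) : mean D ≠ 0 := by
  intro h
  have h2 : ∑' k, D (k + 1) = 0 := by
    refine ENNReal.tsum_eq_zero.2 fun k => ?_
    simpa using ENNReal.tsum_eq_zero.1 h (k + 1)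
  rw [tsum_succ_eq_retentionProb] at h2
  exact retentionProb_ne_zero hD h2

theorem mean_condNonzero_ne_top {D : PMF ℕ} (hD : D 0 ≠ 1) (hmean : mean D ≠ ∞) :
    mean (condNonzero D hD) ≠ ∞ := by
  rw [mean_eq_retentionProb_mul hD] at hmean
  intro h
  rw [h, ENNReal.mul_top (retentionProb_ne_zero hD)] at hmean
  exact hmean rfl

theorem mean_bind {α : Type*} (P : PMF α) (W : α → PMF ℕ) :
    mean (P.bind W) = ∑' x, P x * mean (W x) :=
  tsum_bind_mul P W _

theorem mean_conv (p q : PMF ℕ) : mean (conv p q) = mean p + mean q := by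
  rw [conv, mean_bind]
  have h : ∀ a, mean (q.map fun b => a + b) = a + mean q := by
    intro a
    rw [mean, tsum_map_mul]
    simp only [Nat.cast_add, mul_add, ENNReal.tsum_add, tsum_mul_const]
    rfl
  simp only [h, mul_add, ENNReal.tsum_add, tsum_mul_const]
  rfl

theorem mean_convPow (D : PMF ℕ) (x : ℕ) : mean (convPow D x) = x * mean D := by
  induction x with
  | zero =>
    rw [convPow, mean, tsum_pure_mul]
    simp
  | succ x ih =>
    rw [convPow, mean_conv, ih]
    push_cast
    ring

/-! ### Run decomposition of the repeat channel. -/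

/-- The law of `(x, l)`, where `x` is the number of further input bits of value `b` that contribute
to the current output run, of value `b`, and `l` lists the numbers of further input bits that
contribute to the subsequent output runs. -/
def excessLaw (D : PMF ℕ) : Bool → List Bool → PMF (ℕ × List ℕ)
  | _, [] => PMF.pure (0, [])
  | b, c :: cs =>
    -- A bit of the current value is counted whether or not it is deleted; its number of copies is
    -- sampled later, by the channel.
    if c = b then (excessLaw D b cs).map fun z => (z.1 + 1, z.2)
    else D.bind fun k =>
      if k = 0 then excessLaw D b cs else (excessLaw D c cs).map fun z => (0, z.1 :: z.2)

/-- The law of the first output bit together with, for each output run, the number of input bits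
after its first retained bit that contribute to it. -/
def runLaw (D : PMF ℕ) : List Bool → PMF (Bool × List ℕ)
  -- The bit is arbitrary here: `ofRunLengths` ignores it on the empty list.
  | [] => PMF.pure (true, [])
  | c :: cs => D.bind fun k =>
    if k = 0 then runLaw D cs else (excessLaw D c cs).map fun z => (c, z.1 :: z.2)

/-- The memoryless extension of a channel to lists. -/
def listChannel (W : ℕ → PMF ℕ) : List ℕ → PMF (List ℕ)
  | [] => PMF.pure []
  | x :: l => (prodLaw (W x) (listChannel W l)).map fun z => z.1 :: z.2

/-- The bit string with prescribed first bit and run lengths. -/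
def ofRunLengths : Bool → List ℕ → List Bool
  | _, [] => []
  | b, k :: ks => List.replicate k b ++ ofRunLengths (!b) ks

/-- The law of the length of an output run to which `x` bits after the first retained one
contribute. -/
def excessChannel (D : PMF ℕ) (hD : D 0 ≠ 1) (x : ℕ) : PMF ℕ :=
  conv (condNonzero D hD) (convPow D x)

theorem bind_ite {α β : Type*} (c : Prop) [Decidable c] (p q : PMF α) (f : α → PMF β) :
    (if c then p else q).bind f = if c then p.bind f else q.bind f := by
  split_ifs <;> rfl

theorem prodLaw_bind {α β γ : Type*} (p : PMF α) (q : PMF β) (f : α × β → PMF γ) :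
    (prodLaw p q).bind f = p.bind fun a => q.bind fun b => f (a, b) := by
  simp only [prodLaw, jointLaw, PMF.bind_bind, PMF.bind_map]
  rfl

theorem listChannel_cons_bind {β : Type*} (W : ℕ → PMF ℕ) (x : ℕ) (l : List ℕ)
    (f : List ℕ → PMF β) :
    (listChannel W (x :: l)).bind f =
      (W x).bind fun k => (listChannel W l).bind fun ks => f (k :: ks) := by
  rw [listChannel, PMF.bind_map, prodLaw_bind]
  rfl

theorem conv_bind {β : Type*} (p q : PMF ℕ) (f : ℕ → PMF β) :
    (conv p q).bind f = p.bind fun a => q.bind fun b => f (a + b) := by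
  simp only [conv, PMF.bind_bind, PMF.bind_map]
  rfl

/-- The output of the repeat channel, preceded by the current output run. -/
theorem repeatChannel_eq_excessLaw_bind {D : PMF ℕ} (hD : D 0 ≠ 1) (b : Bool) (cs : List Bool) :
    repeatChannel D cs = (excessLaw D b cs).bind fun z => (convPow D z.1).bind fun k =>
      (listChannel (excessChannel D hD) z.2).bind fun ks =>
        PMF.pure (List.replicate k b ++ ofRunLengths (!b) ks) := by
  induction cs generalizing b with
  | nil => simp [repeatChannel, excessLaw, convPow, listChannel, ofRunLengths]
  | cons c cs ih =>
    rw [repeatChannel, excessLaw]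
    by_cases hc : c = b
    · subst hc
      rw [if_pos rfl, PMF.bind_map]
      simp only [Function.comp_def, convPow, conv_bind]
      -- The copies of this bit are the extra summand of the convolution power, which is sampled
      -- first after the exchange.
      rw [PMF.bind_comm]
      congr 1
      funext k
      rw [ih c]
      simp only [PMF.map_bind, PMF.pure_map, List.replicate_add, List.append_assoc]
    · have hcb : (!b) = c := by cases b <;> cases c <;> simp_all
      have hbc : (!c) = b := by rw [← hcb, Bool.not_not]
      -- `excessLaw` only tests whether `k` is zero, so a nonzero count can be resampled from
      -- `condNonzero` as the contribution of the bit that opens the run.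
      rw [if_neg hc, PMF.bind_bind, bind_eq_bind_ite_condNonzero hD]
      congr 1
      funext k
      rw [bind_ite]
      split_ifs with hk
      · rw [← ih b]
        simp only [List.replicate_zero, List.nil_append]
        exact PMF.map_id _
      · rw [PMF.bind_map]
        simp only [Function.comp_def, convPow, PMF.pure_bind, listChannel_cons_bind,
          List.replicate_zero, List.nil_append, excessChannel, conv_bind, ofRunLengths, hcb, hbc]
        rw [PMF.bind_comm]
        congr 1
        funext k
        rw [ih c]
        simp only [PMF.map_bind, PMF.pure_map, List.replicate_add, List.append_assoc, hbc]

/-- The repeat channel factors through the run decomposition. -/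
theorem repeatChannel_eq_runLaw_bind {D : PMF ℕ} (hD : D 0 ≠ 1) (cs : List Bool) :
    repeatChannel D cs = (runLaw D cs).bind fun z =>
      (listChannel (excessChannel D hD) z.2).map (ofRunLengths z.1) := by
  induction cs with
  | nil => simp [repeatChannel, runLaw, listChannel, ofRunLengths, PMF.pure_map]
  | cons c cs ih =>
    rw [repeatChannel, runLaw, PMF.bind_bind, bind_eq_bind_ite_condNonzero hD]
    congr 1
    funext k
    rw [bind_ite]
    split_ifs with hk
    · rw [← ih]
      simp only [List.replicate_zero, List.nil_append]
      exact PMF.map_id _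
    · rw [PMF.bind_map]
      simp only [Function.comp_def, ← PMF.bind_pure_comp, listChannel_cons_bind, excessChannel,
        conv_bind, ofRunLengths]
      conv_rhs => rw [PMF.bind_comm]
      congr 1
      funext k
      rw [repeatChannel_eq_excessLaw_bind hD c cs]
      simp only [PMF.bind_bind, PMF.pure_bind, List.replicate_add, List.append_assoc]

/-! ### Expected input cost of the runs. -/

theorem tsum_ite_mul {α : Type*} (c : Prop) [Decidable c] (p q : PMF α) (f : α → ℝ≥0∞) :
    ∑' x, (if c then p else q) x * f x = if c then ∑' x, p x * f x else ∑' x, q x * f x := by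
  split_ifs <;> rfl

/-- A bit equal to `b` adds one to the excess. An opposite bit adds `1 / p` with probability p and
nothing otherwise. Either way the expected cost grows by one, independently of `b`. -/
theorem tsum_excessLaw_mul {D : PMF ℕ} (hD : D 0 ≠ 1) (b : Bool) (cs : List Bool) :
    ∑' z, excessLaw D b cs z *
      (z.1 + ((z.2.length : ℝ≥0∞) * (retentionProb D)⁻¹ + (z.2.sum : ℕ))) = cs.length := by
  induction cs generalizing b with
  | nil =>
    rw [excessLaw, tsum_pure_mul]
    simp
  | cons c cs ih =>
    rw [excessLaw]
    by_cases hc : c = b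
    · rw [if_pos hc, tsum_map_mul]
      have : ∀ z : ℕ × List ℕ, (((z.1 + 1 : ℕ) : ℝ≥0∞) +
          ((z.2.length : ℝ≥0∞) * (retentionProb D)⁻¹ + (z.2.sum : ℕ))) =
          (z.1 + ((z.2.length : ℝ≥0∞) * (retentionProb D)⁻¹ + (z.2.sum : ℕ))) + 1 := by
        intro z; push_cast; ring
      simp only [this]
      simp_rw [mul_add _ _ (1 : ℝ≥0∞)]
      rw [ENNReal.tsum_add, ih, tsum_mul_const]
      simp
    · rw [if_neg hc, tsum_bind_mul]
      simp only [tsum_ite_mul, ih, tsum_map_mul]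
      have : ∀ z : ℕ × List ℕ, (((0 : ℕ) : ℝ≥0∞) +
          (((z.1 :: z.2).length : ℝ≥0∞) * (retentionProb D)⁻¹ + ((z.1 :: z.2).sum : ℕ))) =
          (z.1 + ((z.2.length : ℝ≥0∞) * (retentionProb D)⁻¹ + (z.2.sum : ℕ))) +
            (retentionProb D)⁻¹ := by
        intro z
        simp only [List.length_cons, List.sum_cons]
        push_cast; ring
      simp only [this]
      simp_rw [mul_add _ _ (retentionProb D)⁻¹]
      rw [ENNReal.tsum_add, ih, tsum_mul_const, tsum_mul_ite_zero, mul_add, ← add_assoc, ← add_mul,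
        add_retentionProb, ENNReal.mul_inv_cancel (retentionProb_ne_zero hD)
          (retentionProb_ne_top D)]
      simp

/-- On average, each output run accounts for `1 / p` input bits plus the further bits that
contribute to it. -/
theorem tsum_runLaw_mul {D : PMF ℕ} (hD : D 0 ≠ 1) (cs : List Bool) :
    ∑' z, runLaw D cs z * ((z.2.length : ℝ≥0∞) * (retentionProb D)⁻¹ + (z.2.sum : ℕ)) =
      cs.length := by
  induction cs with
  | nil =>
    rw [runLaw, tsum_pure_mul]
    simp
  | cons c cs ih =>
    rw [runLaw, tsum_bind_mul]
    simp only [tsum_ite_mul, ih, tsum_map_mul]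
    have : ∀ z : ℕ × List ℕ,
        (((z.1 :: z.2).length : ℝ≥0∞) * (retentionProb D)⁻¹ + ((z.1 :: z.2).sum : ℕ)) =
        (z.1 + ((z.2.length : ℝ≥0∞) * (retentionProb D)⁻¹ + (z.2.sum : ℕ))) +
          (retentionProb D)⁻¹ := by
      intro z
      simp only [List.length_cons, List.sum_cons]
      push_cast; ring
    simp only [this]
    simp_rw [mul_add _ _ (retentionProb D)⁻¹]
    rw [ENNReal.tsum_add, tsum_excessLaw_mul hD, tsum_mul_const, tsum_mul_ite_zero, mul_add,
      ← add_assoc, ← add_mul, add_retentionProb,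
      ENNReal.mul_inv_cancel (retentionProb_ne_zero hD) (retentionProb_ne_top D)]
    simp

/-- Each run is opened by its own input bit. The bound leaves finitely many run counts, so that
fixing the count costs only a logarithm. -/
theorem length_le_of_mem_support_excessLaw {D : PMF ℕ} {b : Bool} {cs : List Bool}
    {z : ℕ × List ℕ} (hz : z ∈ (excessLaw D b cs).support) : z.2.length ≤ cs.length := by
  induction cs generalizing b z with
  | nil =>
    rw [excessLaw, PMF.mem_support_pure_iff] at hz
    simp [hz]
  | cons c cs ih =>
    rw [excessLaw] at hz
    split_ifs at hz with hc
    · obtain ⟨w, hw, rfl⟩ := (PMF.mem_support_map_iff _ _ _).1 hz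
      exact (ih hw).trans (Nat.le_succ _)
    · obtain ⟨k, -, hk⟩ := (PMF.mem_support_bind_iff _ _ _).1 hz
      split_ifs at hk
      · exact (ih hk).trans (Nat.le_succ _)
      · obtain ⟨w, hw, rfl⟩ := (PMF.mem_support_map_iff _ _ _).1 hk
        exact Nat.succ_le_succ (ih hw)

theorem length_le_of_mem_support_runLaw {D : PMF ℕ} {cs : List Bool}
    {z : Bool × List ℕ} (hz : z ∈ (runLaw D cs).support) : z.2.length ≤ cs.length := by
  induction cs with
  | nil =>
    rw [runLaw, PMF.mem_support_pure_iff] at hz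
    simp [hz]
  | cons c cs ih =>
    rw [runLaw] at hz
    obtain ⟨k, -, hk⟩ := (PMF.mem_support_bind_iff _ _ _).1 hz
    split_ifs at hk
    · exact (ih hk).trans (Nat.le_succ _)
    · obtain ⟨w, hw, rfl⟩ := (PMF.mem_support_map_iff _ _ _).1 hk
      exact Nat.succ_le_succ (length_le_of_mem_support_excessLaw hw)

/-! ### From one run to lists of runs. -/

/-- A bound on the mean-limited capacities, in terms of the law of the excess. -/
theorem mutualInfo_excessChannel_le {D : PMF ℕ} (hD : D 0 ≠ 1) (hmean : mean D ≠ ∞) {S : ℝ≥0∞}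
    (hS : ∀ μ : ℝ≥0, mean (condNonzero D hD) ≤ μ →
      meanLimitedCapacity (runChannel D hD) μ /
        (1 / retentionProb D + ((μ : ℝ≥0∞) - mean (condNonzero D hD)) / mean D) ≤ S)
    (R : PMF ℕ) (hR : ∑' x, R x * (x : ℝ≥0∞) ≠ ∞) :
    mutualInfo R (excessChannel D hD) ≤
      S * ((retentionProb D)⁻¹ + ∑' x, R x * (x : ℝ≥0∞)) := by
  set e := ∑' x, R x * (x : ℝ≥0∞) with he
  set r := mean (condNonzero D hD) with hr
  have hrt : r ≠ ∞ := mean_condNonzero_ne_top hD hmean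
  have hm0 := mean_ne_zero hD
  have hW : ∀ x : ℕ, runChannel D hD x.succPNat = excessChannel D hD x := fun x => rfl
  have hout : (R.map Nat.succPNat).bind (runChannel D hD) = R.bind (excessChannel D hD) := by
    rw [PMF.bind_map]
    rfl
  have hinfo : mutualInfo (R.map Nat.succPNat) (runChannel D hD) =
      mutualInfo R (excessChannel D hD) := by
    rw [mutualInfo_eq_tsum, mutualInfo_eq_tsum, tsum_map_mul, hout]
    simp_rw [hW]
  have hmu : mean ((R.map Nat.succPNat).bind (runChannel D hD)) = r + e * mean D := by
    rw [hout, mean_bind]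
    simp only [excessChannel, mean_conv, mean_convPow, mul_add, ENNReal.tsum_add, tsum_mul_const,
      ← mul_assoc, ENNReal.tsum_mul_right]
    rfl
  have hfin : r + e * mean D ≠ ∞ := by finiteness
  have hcoe : (((r + e * mean D).toNNReal : ℝ≥0) : ℝ≥0∞) = r + e * mean D :=
    ENNReal.coe_toNNReal hfin
  -- At the exact output mean the denominator reduces to `1 / p + e`.
  have h1 := hS (r + e * mean D).toNNReal (by rw [hcoe]; exact le_self_add)
  have hp0 := retentionProb_ne_zero hD
  rw [hcoe, ENNReal.add_sub_cancel_left hrt, ENNReal.mul_div_cancel_right hm0 hmean, one_div,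
    ENNReal.div_le_iff (by simp [retentionProb_ne_top]) (by finiteness)] at h1
  rw [← hinfo]
  refine le_trans ?_ h1
  exact le_iSup₂_of_le (R.map Nat.succPNat) (hmu.trans hcoe.symm) le_rfl

/-- A linear bound on the information of a channel tensorizes over lists of fixed length. -/
theorem exists_tsum_klDivergence_listChannel_le (W : ℕ → PMF ℕ) {S c : ℝ≥0∞}
    (hW : ∀ R : PMF ℕ, ∑' x, R x * (x : ℝ≥0∞) ≠ ∞ →
      mutualInfo R W ≤ S * (c + ∑' x, R x * (x : ℝ≥0∞)))
    (m : ℕ) (R : PMF (List ℕ)) (hR : ∀ l ∈ R.support, l.length = m)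
    (hfin : ∑' l, R l * ((l.sum : ℕ) : ℝ≥0∞) ≠ ∞) :
    ∃ Q : PMF (List ℕ), ∑' l, R l * klDivergence (listChannel W l) Q ≤
      S * (m * c + ∑' l, R l * ((l.sum : ℕ) : ℝ≥0∞)) := by
  induction m generalizing R with
  | zero =>
    refine ⟨PMF.pure [], ?_⟩
    calc ∑' l, R l * klDivergence (listChannel W l) (PMF.pure [])
        ≤ ∑' l, R l * 0 := by
          refine tsum_mul_le_of_support R fun l hl => ?_
          rw [List.length_eq_zero_iff.1 (hR l hl), listChannel, klDivergence,
            InformationTheory.klDiv_self]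
      _ ≤ _ := by simp
  | succ m ih =>
    -- With default head 0 the splitting also holds for the empty list.
    have hsplit : ∑' l, R l * ((l.sum : ℕ) : ℝ≥0∞) =
        ∑' x, R.map (fun l => l.headD 0) x * (x : ℝ≥0∞) +
          ∑' l, R.map List.tail l * ((l.sum : ℕ) : ℝ≥0∞) := by
      rw [tsum_map_mul, tsum_map_mul, ← ENNReal.tsum_add]
      refine tsum_congr fun l => ?_
      cases l <;> simp [mul_add]
    have hf := hfin
    rw [hsplit, ENNReal.add_ne_top] at hf
    obtain ⟨Q, hQ⟩ := ih (R.map List.tail) (by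
      intro l hl
      obtain ⟨l', hl', rfl⟩ := (PMF.mem_support_map_iff _ _ _).1 hl
      rw [List.length_tail, hR l' hl', Nat.add_sub_cancel]) hf.2
    have h0 := hW (R.map fun l => l.headD 0) hf.1
    set Q0 := (R.map fun l => l.headD 0).bind W with hQ0
    rw [mutualInfo_eq_tsum, ← hQ0, tsum_map_mul] at h0
    rw [tsum_map_mul (f := fun l => klDivergence (listChannel W l) Q)] at hQ
    -- Against a product reference law the divergence splits by coordinate for each fixed list, so
    -- dependence between the entries of the list plays no role.
    refine ⟨(prodLaw Q0 Q).map fun z => z.1 :: z.2, ?_⟩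
    calc ∑' l, R l * klDivergence (listChannel W l) ((prodLaw Q0 Q).map fun z => z.1 :: z.2)
        ≤ ∑' l, R l * (klDivergence (W (l.headD 0)) Q0 +
            klDivergence (listChannel W l.tail) Q) := by
          refine tsum_mul_le_of_support R fun l hl => ?_
          cases l with
          | nil => simpa using hR _ hl
          | cons x l =>
            rw [listChannel]
            exact (klDivergence_map_map_le _ _ _).trans (klDivergence_prodLaw _ _ _ _).le
      _ ≤ S * (c + ∑' x, R.map (fun l => l.headD 0) x * (x : ℝ≥0∞)) +
            S * (m * c + ∑' l, R.map List.tail l * ((l.sum : ℕ) : ℝ≥0∞)) := by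
          simp_rw [mul_add (R _)]
          rw [ENNReal.tsum_add]
          exact add_le_add h0 hQ
      _ = S * ((m + 1 : ℕ) * c + ∑' l, R l * ((l.sum : ℕ) : ℝ≥0∞)) := by
          rw [hsplit]; push_cast; ring

/-- The divergence from a uniform mixture exceeds that from a component by at most the logarithm of
the number of components. -/
theorem klDivergence_bind_uniform_le {ι α : Type*} [Fintype ι] [Nonempty ι] [Countable α]
    (p : PMF α) (q : ι → PMF α) (i : ι) :
    klDivergence p ((PMF.uniformOfFintype ι).bind q) ≤
      klDivergence p (q i) + ENNReal.ofReal (Real.log (Fintype.card ι)) := by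
  refine klDivergence_le_add_log _ _ _ (by exact_mod_cast Fintype.card_pos) fun x => ?_
  rw [ENNReal.ofReal_natCast, PMF.bind_apply]
  simp_rw [PMF.uniformOfFintype_apply]
  rw [ENNReal.tsum_mul_left, ← mul_assoc,
    ENNReal.mul_inv_cancel (by simp) (by simp), one_mul]
  exact ENNReal.le_tsum i

/-- Once the first bit and the number of runs are fixed, lists have constant length and the
tensorized bound applies. These data take at most 2 (n + 1) values, so the uniform mixture of the
conditional reference laws loses at most the logarithm of that number. -/
theorem exists_tsum_klDivergence_ofRunLengths_le (W : ℕ → PMF ℕ) {S c : ℝ≥0∞}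
    (hW : ∀ R : PMF ℕ, ∑' x, R x * (x : ℝ≥0∞) ≠ ∞ →
      mutualInfo R W ≤ S * (c + ∑' x, R x * (x : ℝ≥0∞)))
    (n : ℕ) (L : PMF (Bool × List ℕ)) (hL : ∀ z ∈ L.support, z.2.length ≤ n)
    (hfin : ∑' z, L z * ((z.2.sum : ℕ) : ℝ≥0∞) ≠ ∞) :
    ∃ Q : PMF (List Bool),
      ∑' z, L z * klDivergence ((listChannel W z.2).map (ofRunLengths z.1)) Q ≤
        S * (∑' z, L z * ((z.2.length : ℝ≥0∞) * c + (z.2.sum : ℕ))) +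
          ENNReal.ofReal (Real.log ((2 * (n + 1) : ℕ) : ℝ)) := by
  obtain ⟨κ, hκ, hκs⟩ := exists_disintegration L fun z => (z.1, z.2.length)
  set N := L.map fun z => (z.1, z.2.length) with hN
  have hNle : ∀ y ∈ N.support, y.2 ≤ n := by
    intro y hy
    obtain ⟨z, hz, rfl⟩ := (PMF.mem_support_map_iff _ _ _).1 hy
    exact hL z hz
  have hdis : ∀ f : Bool × List ℕ → ℝ≥0∞,
      ∑' z, L z * f z = ∑' y, N y * ∑' z, κ y z * f z := fun f => by
    rw [← tsum_bind_mul, hκ]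
  have hex : ∀ y, ∃ Q : PMF (List ℕ), y ∈ N.support →
      ∑' z, κ y z * klDivergence (listChannel W z.2) Q ≤
        S * ∑' z, κ y z * ((z.2.length : ℝ≥0∞) * c + (z.2.sum : ℕ)) := by
    intro y
    by_cases hy : y ∈ N.support
    · have hlen : ∀ z ∈ (κ y).support, z.2.length = y.2 := fun z hz =>
        congrArg Prod.snd (hκs y hy z hz)
      -- A fibre of positive mass inherits a finite mean from the total.
      have hf : ∑' z, κ y z * ((z.2.sum : ℕ) : ℝ≥0∞) ≠ ∞ := by
        intro h
        rw [hdis] at hfin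
        refine hfin (ENNReal.tsum_eq_top_of_eq_top ⟨y, ?_⟩)
        rw [h, ENNReal.mul_top hy]
      obtain ⟨Q, hQ⟩ := exists_tsum_klDivergence_listChannel_le W hW y.2 ((κ y).map Prod.snd)
        (by
          intro l hl
          obtain ⟨z, hz, rfl⟩ := (PMF.mem_support_map_iff _ _ _).1 hl
          exact hlen z hz) (by rwa [tsum_map_mul])
      rw [tsum_map_mul, tsum_map_mul] at hQ
      refine ⟨Q, fun _ => hQ.trans ?_⟩
      gcongr
      simp_rw [mul_add (κ y _)]
      rw [ENNReal.tsum_add]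
      gcongr
      rw [← tsum_mul_const (κ y) (y.2 * c)]
      exact tsum_mul_le_of_support _ fun z hz => by rw [hlen z hz]
    · exact ⟨PMF.pure [], fun h => absurd h hy⟩
  choose Q hQ using hex
  refine ⟨(PMF.uniformOfFintype (Bool × Fin (n + 1))).bind fun y =>
    (Q (y.1, y.2)).map (ofRunLengths y.1), ?_⟩
  rw [hdis, hdis, ← ENNReal.tsum_mul_left]
  set M := (PMF.uniformOfFintype (Bool × Fin (n + 1))).bind fun y =>
    (Q (y.1, y.2)).map (ofRunLengths y.1) with hM
  set ℓ := ENNReal.ofReal (Real.log ((2 * (n + 1) : ℕ) : ℝ)) with hℓ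
  calc ∑' y, N y * ∑' z, κ y z * klDivergence ((listChannel W z.2).map (ofRunLengths z.1)) M
      ≤ ∑' y, N y * (S * (∑' z, κ y z * ((z.2.length : ℝ≥0∞) * c + (z.2.sum : ℕ))) + ℓ) := by
        refine tsum_mul_le_of_support N fun y hy => ?_
        calc ∑' z, κ y z * klDivergence ((listChannel W z.2).map (ofRunLengths z.1)) M
            ≤ ∑' z, κ y z * (klDivergence (listChannel W z.2) (Q y) + ℓ) := by
              refine tsum_mul_le_of_support (κ y) fun z hz => ?_
              have hz1 : z.1 = y.1 := congrArg Prod.fst (hκs y hy z hz)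
              have h := klDivergence_bind_uniform_le
                ((listChannel W z.2).map (ofRunLengths z.1))
                (fun y : Bool × Fin (n + 1) => (Q (y.1, y.2)).map (ofRunLengths y.1))
                (y.1, ⟨y.2, Nat.lt_succ_of_le (hNle y hy)⟩)
              rw [← hM, Fintype.card_prod, Fintype.card_bool, Fintype.card_fin, ← hℓ, hz1] at h
              rw [hz1]
              exact h.trans (add_le_add_left (klDivergence_map_map_le _ _ _) _)
          _ = ∑' z, κ y z * klDivergence (listChannel W z.2) (Q y) + ℓ := by
              simp_rw [mul_add (κ y _)]
              rw [ENNReal.tsum_add, tsum_mul_const]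
          _ ≤ _ := add_le_add_left (hQ y hy) _
    _ = ∑' y, S * (N y * ∑' z, κ y z * ((z.2.length : ℝ≥0∞) * c + (z.2.sum : ℕ))) + ℓ := by
        simp_rw [mul_add (N _)]
        rw [ENNReal.tsum_add, tsum_mul_const]
        simp_rw [mul_left_comm S]

/-! ### Capacity bound. -/

/-- Mutual information is bounded through one reference law for all inputs, and convexity passes
from output strings to the hidden run data, whose expected cost is exactly `n`. -/
theorem maxInfo_le {D : PMF ℕ} (hD : D 0 ≠ 1) {S : ℝ≥0∞}
    (hS : ∀ R : PMF ℕ, ∑' x, R x * (x : ℝ≥0∞) ≠ ∞ → mutualInfo R (excessChannel D hD) ≤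
      S * ((retentionProb D)⁻¹ + ∑' x, R x * (x : ℝ≥0∞))) (n : ℕ) :
    maxInfo D n ≤ S * n + ENNReal.ofReal (Real.log ((2 * (n + 1) : ℕ) : ℝ)) := by
  refine iSup_le fun P => ?_
  set L := P.bind fun x => runLaw D (List.ofFn x) with hLdef
  have hcost : ∑' z, L z * ((z.2.length : ℝ≥0∞) * (retentionProb D)⁻¹ + (z.2.sum : ℕ)) = n := by
    rw [tsum_bind_mul]
    simp only [tsum_runLaw_mul hD, List.length_ofFn, tsum_mul_const]
  obtain ⟨Q, hQ⟩ := exists_tsum_klDivergence_ofRunLengths_le (excessChannel D hD) hS n L (by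
      intro z hz
      obtain ⟨x, -, hx⟩ := (PMF.mem_support_bind_iff _ _ _).1 hz
      simpa using length_le_of_mem_support_runLaw hx) (by
      refine ne_top_of_le_ne_top (ENNReal.natCast_ne_top n) (le_trans ?_ hcost.le)
      exact tsum_mul_le_of_support L fun z _ => le_add_self)
  rw [hcost] at hQ
  refine le_trans ?_ hQ
  calc mutualInfo P (fun x => repeatChannel D (List.ofFn x))
      ≤ ∑' x, P x * klDivergence (repeatChannel D (List.ofFn x)) Q := mutualInfo_le_tsum _ _ _
    _ ≤ ∑' x, P x * ∑' z, runLaw D (List.ofFn x) z *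
          klDivergence ((listChannel (excessChannel D hD) z.2).map (ofRunLengths z.1)) Q := by
        refine ENNReal.tsum_le_tsum fun x => mul_le_mul_right ?_ _
        rw [repeatChannel_eq_runLaw_bind hD]
        exact klDivergence_bind_le _ _ _
    _ = ∑' z, L z *
          klDivergence ((listChannel (excessChannel D hD) z.2).map (ofRunLengths z.1)) Q :=
        (tsum_bind_mul _ _ _).symm

theorem tendsto_log_two_mul_div :
    Filter.Tendsto (fun n : ℕ => ENNReal.ofReal (Real.log ((2 * (n + 1) : ℕ) : ℝ) / n))
      Filter.atTop (nhds 0) := by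
  have h1 : Filter.Tendsto (fun n : ℕ => Real.log n / n) Filter.atTop (nhds 0) :=
    (Real.isLittleO_log_id_atTop.tendsto_div_nhds_zero).comp tendsto_natCast_atTop_atTop
  -- The 4 comes from `2 (n + 1) ≤ 4 n` for `n ≥ 1`.
  have h2 : Filter.Tendsto (fun n : ℕ => Real.log 4 / n + Real.log n / n) Filter.atTop
      (nhds 0) := by
    simpa using (tendsto_const_div_atTop_nhds_zero_nat (Real.log 4)).add h1
  rw [← ENNReal.ofReal_zero]
  refine (ENNReal.continuous_ofReal.tendsto 0).comp ?_
  refine tendsto_of_tendsto_of_tendsto_of_le_of_le' tendsto_const_nhds h2 ?_ ?_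
  · filter_upwards with n
    exact div_nonneg (Real.log_natCast_nonneg _) (Nat.cast_nonneg n)
  · filter_upwards [Filter.eventually_ge_atTop 1] with n hn
    have hn' : (1 : ℝ) ≤ n := by exact_mod_cast hn
    rw [← add_div, ← Real.log_mul (by norm_num) (by positivity)]
    gcongr
    push_cast
    linarith

theorem capacity_le_of_mutualInfo_excessChannel_le {D : PMF ℕ} (hD : D 0 ≠ 1) {S : ℝ≥0∞}
    (hS : ∀ R : PMF ℕ, ∑' x, R x * (x : ℝ≥0∞) ≠ ∞ → mutualInfo R (excessChannel D hD) ≤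
      S * ((retentionProb D)⁻¹ + ∑' x, R x * (x : ℝ≥0∞))) :
    capacity D ≤ S := by
  have ht : Filter.Tendsto
      (fun n : ℕ => S + ENNReal.ofReal (Real.log ((2 * (n + 1) : ℕ) : ℝ) / n))
      Filter.atTop (nhds (S + 0)) := tendsto_const_nhds.add tendsto_log_two_mul_div
  rw [add_zero] at ht
  rw [← ht.limsup_eq]
  refine Filter.limsup_le_limsup ?_
  filter_upwards [Filter.eventually_ge_atTop 1] with n hn
  have hn0 : (n : ℝ≥0∞) ≠ 0 := by exact_mod_cast (by omega : n ≠ 0)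
  have hn1 : (0 : ℝ) < n := by exact_mod_cast hn
  rw [ENNReal.div_le_iff hn0 (ENNReal.natCast_ne_top n), add_mul,
    ← ENNReal.ofReal_natCast n, ← ENNReal.ofReal_mul (by
      exact div_nonneg (Real.log_natCast_nonneg _) (Nat.cast_nonneg n)),
    div_mul_cancel₀ _ hn1.ne', ENNReal.ofReal_natCast]
  exact maxInfo_le hD hS n

/-! ### Comparison with the convolution channel. -/

/-- Revealing the contribution of the first retained bit does not decrease the information. -/
theorem mutualInfo_excessChannel_le_convolutionChannel {D : PMF ℕ} (hD : D 0 ≠ 1) (R : PMF ℕ) :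
    mutualInfo R (excessChannel D hD) ≤ mutualInfo R (convolutionChannel D) := by
  -- Adding an independent sample is a kernel acting on `q`, the form required for data processing.
  have hW : ∀ q : PMF ℕ, conv (condNonzero D hD) q =
      q.bind fun b => (condNonzero D hD).map fun a => a + b := by
    intro q
    simp only [conv, ← PMF.bind_pure_comp]
    exact PMF.bind_comm _ _ _
  refine (mutualInfo_le_tsum R _ (conv (condNonzero D hD) (R.bind (convolutionChannel D)))).trans ?_
  rw [mutualInfo_eq_tsum]
  refine ENNReal.tsum_le_tsum fun x => mul_le_mul_right ?_ _
  rw [excessChannel, hW, hW]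
  exact klDivergence_bind_bind_le _ _ _

/-- An input of mean e has output mean `e * mean D`, at which the denominator is `1 / p + e`. -/
theorem mutualInfo_convolutionChannel_le {D : PMF ℕ} (hD : D 0 ≠ 1) (hmean : mean D ≠ ∞)
    {S : ℝ≥0∞}
    (hS : ∀ μ : ℝ≥0, meanLimitedCapacity (convolutionChannel D) μ /
        (1 / retentionProb D + (μ : ℝ≥0∞) / mean D) ≤ S)
    (R : PMF ℕ) (hR : ∑' x, R x * (x : ℝ≥0∞) ≠ ∞) :
    mutualInfo R (convolutionChannel D) ≤
      S * ((retentionProb D)⁻¹ + ∑' x, R x * (x : ℝ≥0∞)) := by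
  set e := ∑' x, R x * (x : ℝ≥0∞) with he
  have hp0 := retentionProb_ne_zero hD
  have hmu : mean (R.bind (convolutionChannel D)) = e * mean D := by
    rw [mean_bind]
    simp only [convolutionChannel, mean_convPow, ← mul_assoc, ENNReal.tsum_mul_right]
    rfl
  have hcoe : (((e * mean D).toNNReal : ℝ≥0) : ℝ≥0∞) = e * mean D :=
    ENNReal.coe_toNNReal (by finiteness)
  have h1 := hS (e * mean D).toNNReal
  rw [hcoe, ENNReal.mul_div_cancel_right (mean_ne_zero hD) hmean, one_div,
    ENNReal.div_le_iff (by simp [retentionProb_ne_top]) (by finiteness)] at h1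
  exact le_trans (le_iSup₂_of_le R (hmu.trans hcoe.symm) le_rfl) h1

end

end RepeatChannel

theorem mainTheorem3 (D : PMF ℕ) (hD : D 0 ≠ 1) (hmean : RepeatChannel.mean D ≠ ∞) :
    RepeatChannel.capacity D ≤
        ⨆ (μ : ℝ≥0) (_ : RepeatChannel.mean (RepeatChannel.condNonzero D hD) ≤ (μ : ℝ≥0∞)),
          RepeatChannel.meanLimitedCapacity (RepeatChannel.runChannel D hD) μ /
            (1 / RepeatChannel.retentionProb D +
              ((μ : ℝ≥0∞) - RepeatChannel.mean (RepeatChannel.condNonzero D hD)) /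
                RepeatChannel.mean D) ∧
      RepeatChannel.capacity D ≤
        ⨆ μ : ℝ≥0,
          RepeatChannel.meanLimitedCapacity (RepeatChannel.convolutionChannel D) μ /
            (1 / RepeatChannel.retentionProb D + (μ : ℝ≥0∞) / RepeatChannel.mean D) := by
  constructor
  · refine RepeatChannel.capacity_le_of_mutualInfo_excessChannel_le hD
      (RepeatChannel.mutualInfo_excessChannel_le hD hmean fun μ hμ => ?_)
    exact le_iSup₂_of_le μ hμ le_rfl
  · refine RepeatChannel.capacity_le_of_mutualInfo_excessChannel_le hD fun R hR =>
      (RepeatChannel.mutualInfo_excessChannel_le_convolutionChannel hD R).trans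
        (RepeatChannel.mutualInfo_convolutionChannel_le hD hmean (fun μ => ?_) R hR)
    exact le_iSup_of_le μ le_rfl
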